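/- **The calculus $F_{<:Q}$.** All syntax is taken up to renaming of bound variables. There are three kinds of variables: term variables $x$, type variables $X$, qualifier variables $Y$. - Qualifiers: $P,Q,R ::= \top \mid \bot \mid Y \mid Q\wedge R \mid Q\vee R$. - Simple types: $S ::= \top \mid X \mid T_1\to T_2 \mid \forall(X<:S).T \mid \forall(Y<:Q).T$. Qualified types: $T,U ::= \{Q\}\,S$. - Terms: $s,t ::= x \mid \lambda(x)_P.t \mid s(t) \mid \Lambda(X<:S)_P.t \mid s[S] \mid \Lambda(Y<:Q)_P.t \mid s\{\!\{Q\}\!\} \mid \mathsf{upqual}\,P\,s \mid \mathsf{assert}\,P\,s$. Values $v$ are the three forms of abstraction; the subscript $P$ is the tag of the value. - Environments: $\Gamma ::= \cdot \mid \Gamma,x:T \mid \Gamma,X<:S \mid \Gamma,Y<:Q$. Qualifiers, types and environments are well-formed if all their free variables are bound in the (preceding part of the) environment. In the judgements below, all environments, types and qualifiers are required to be well-formed. *Reduction* $s\longrightarrow t$. For a qualifier $Q$ without variables let $\mathrm{eval}(Q)$ be its value in the two-point lattice $\{\bot\sqsubseteq\top\}$; $\mathrm{eval}(Q)$ is undefined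 if $Q$ contains a variable. The rules are $(\lambda(x)_P.t)(v)\longrightarrow t[x\mapsto v]$; $(\Lambda(X<:S)_P.t)[S']\longrightarrow t[X\mapsto S']$; $(\Lambda(Y<:Q)_P.t)\{\!\{Q'\}\!\}\longrightarrow t[Y\mapsto Q']$; and, for a value $v$ with tag $P$ such that $\mathrm{eval}(P)$ and $\mathrm{eval}(R)$ are defined and $\mathrm{eval}(P)\sqsubseteq\mathrm{eval}(R)$: $\mathsf{upqual}\,R\,v\longrightarrow v'$, where $v'$ is $v$ with its tag replaced by $R$, and $\mathsf{assert}\,R\,v\longrightarrow v$. Reduction is closed under the evaluation contexts $E ::= [\,] \mid E(t) \mid v(E) \mid E[S] \mid E\{\!\{Q\}\!\} \mid \mathsf{upqual}\,P\,E \mid \mathsf{assert}\,P\,E$. *Subqualification* $\Gamma\vdash Q<:R$ is generated by: $\Gamma\vdash Q<:\top$; $\Gamma\vdash\bot<:Q$; $\Gamma\vdash Y<:Y$; if $(Y<:Q)\in\Gamma$ and $\Gamma\vdash Q<:R$, then $\Gamma\vdash Y<:R$; if $\Gamma\vdash Q<:R_i$ for some $i\in\{1,2\}$, then $\Gamma\vdash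 Q<:R_1\vee R_2$; if $\Gamma\vdash Q_1<:R$ and $\Gamma\vdash Q_2<:R$, then $\Gamma\vdash Q_1\vee Q_2<:R$; if $\Gamma\vdash Q_i<:R$ for some $i\in\{1,2\}$, then $\Gamma\vdash Q_1\wedge Q_2<:R$; if $\Gamma\vdash Q<:R_1$ and $\Gamma\vdash Q<:R_2$, then $\Gamma\vdash Q<:R_1\wedge R_2$. *Subtyping* is generated by: $\Gamma\vdash S<:\top$; $\Gamma\vdash X<:X$; if $(X<:S)\in\Gamma$ and $\Gamma\vdash S<:S'$, then $\Gamma\vdash X<:S'$; if $\Gamma\vdash U_1<:T_1$ and $\Gamma\vdash T_2<:U_2$, then $\Gamma\vdash T_1\to T_2<:U_1\to U_2$; if $\Gamma\vdash S_2<:S_1$ and $\Gamma,X<:S_2\vdash T_1<:T_2$, then $\Gamma\vdash\forall(X<:S_1).T_1<:\forall(X<:S_2).T_2$; if $\Gamma\vdash Q_2<:Q_1$ and $\Gamma,Y<:Q_2\vdash T_1<:T_2$, then $\Gamma\vdash\forall(Y<:Q_1).T_1<:\forall(Y<:Q_2).T_2$; if $\Gamma\vdash Q_1<:Q_2$ and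 $\Gamma\vdash S_1<:S_2$, then $\Gamma\vdash\{Q_1\}S_1<:\{Q_2\}S_2$. *Typing* $\Gamma\vdash t:T$ is generated by: if $(x:T)\in\Gamma$, then $\Gamma\vdash x:T$; if $\Gamma,x:T_1\vdash t:T_2$, then $\Gamma\vdash\lambda(x)_P.t:\{P\}(T_1\to T_2)$; if $\Gamma,X<:S\vdash t:T$, then $\Gamma\vdash\Lambda(X<:S)_P.t:\{P\}\,\forall(X<:S).T$; if $\Gamma,Y<:Q\vdash t:T$, then $\Gamma\vdash\Lambda(Y<:Q)_P.t:\{P\}\,\forall(Y<:Q).T$; if $\Gamma\vdash s:\{Q\}(T_1\to T_2)$ and $\Gamma\vdash t:T_1$, then $\Gamma\vdash s(t):T_2$; if $\Gamma\vdash s:\{Q\}\,\forall(X<:S).T$ and $\Gamma\vdash S'<:S$, then $\Gamma\vdash s[S']:T[X\mapsto S']$; if $\Gamma\vdash s:\{R\}\,\forall(Y<:Q).T$ and $\Gamma\vdash Q'<:Q$, then $\Gamma\vdash s\{\!\{Q'\}\!\}:T[Y\mapsto Q']$; if $\Gamma\vdash s:\{Q\}S$ and $\Gamma\vdash Q<:P$,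 then $\Gamma\vdash\mathsf{assert}\,P\,s:\{Q\}S$ and $\Gamma\vdash\mathsf{upqual}\,P\,s:\{P\}S$; if $\Gamma\vdash s:T_1$ and $\Gamma\vdash T_1<:T_2$, then $\Gamma\vdash s:T_2$. **Theorem (Preservation for $F_{<:Q}$).** Let $\Gamma$ be an environment, $s,t$ terms and $T$ a qualified type. If $\Gamma\vdash s:T$ and $s\longrightarrow t$, then $\Gamma\vdash t:T$. -/

import Mathlib

/-!
The calculus `F<:Q`: System F-sub with type qualifiers and with bounded polymorphism over simple
types and over qualifiers.

Terms, types and qualifiers are represented up to renaming of bound variables by de Bruijn indices,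
with three separate index spaces: term variables `x`, type variables `X`, qualifier variables `Y`.
A term binder shifts only term variables, a type binder only type variables, a qualifier binder
only qualifier variables.
-/

namespace FsubQ

/-! ### Qualifiers -/

/-- Qualifier expressions `P, Q, R ::= ⊤ | ⊥ | Y | Q ∧ R | Q ∨ R`: lattice formulas over the
two-point lattice, with qualifier variables.  They are ordered by `SubQual` below. -/
inductive Qual : Type
  | top : Qual
  | bot : Qual
  | var : ℕ → Qual
  | meet : Qual → Qual → Qual
  | join : Qual → Qual → Qual

/-- The concrete qualifier denoted by a qualifier expression, in the two-point lattice `Bool`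
(`⊥ = false`, `⊤ = true`).  It is undefined if the expression contains a variable. -/
def Qual.eval : Qual → Option Bool
  | .top => some ⊤
  | .bot => some ⊥
  | .var _ => none
  | .meet Q R => do
      let c ← Q.eval
      let d ← R.eval
      return c ⊓ d
  | .join Q R => do
      let c ← Q.eval
      let d ← R.eval
      return c ⊔ d

/-- Extension of a renaming of indices below a binder. -/
def liftRen (ξ : ℕ → ℕ) : ℕ → ℕ
  | 0 => 0
  | n + 1 => ξ n + 1

/-- Renaming of the qualifier variables of a qualifier. -/
def Qual.rename (ξ : ℕ → ℕ) : Qual → Qual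
  | .top => .top
  | .bot => .bot
  | .var Y => .var (ξ Y)
  | .meet Q R => .meet (Q.rename ξ) (R.rename ξ)
  | .join Q R => .join (Q.rename ξ) (R.rename ξ)

/-- Simultaneous substitution of qualifiers for the qualifier variables of a qualifier. -/
def Qual.subst (θ : ℕ → Qual) : Qual → Qual
  | .top => .top
  | .bot => .bot
  | .var Y => θ Y
  | .meet Q R => .meet (Q.subst θ) (R.subst θ)
  | .join Q R => .join (Q.subst θ) (R.subst θ)

/-- Extension of a qualifier substitution below a qualifier binder. -/
def Qual.lift (θ : ℕ → Qual) : ℕ → Qual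
  | 0 => .var 0
  | n + 1 => (θ n).rename Nat.succ

/-- The substitution that sends index `0` to `Q` and lowers all other indices by one. -/
def Qual.single (Q : Qual) : ℕ → Qual
  | 0 => Q
  | n + 1 => .var n

/-! ### Types -/

/-- The two classes of types: simple types `S` and qualified types `T`. -/
inductive Kind : Type
  | simple : Kind
  | qualified : Kind

/-- Simple types `S ::= ⊤ | X | T₁ → T₂ | ∀(X <: S). T | ∀(Y <: Q). T` and
qualified types `T ::= {Q} S`, as one inductive family.  In `all S T` index `0` of the type
variables is bound in `T`; in `qall Q T` index `0` of the qualifier variables is bound in `T`. -/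
inductive Ty : Kind → Type
  | top : Ty .simple
  | var : ℕ → Ty .simple
  | arrow : Ty .qualified → Ty .qualified → Ty .simple
  | all : Ty .simple → Ty .qualified → Ty .simple
  | qall : Qual → Ty .qualified → Ty .simple
  | qual : Qual → Ty .simple → Ty .qualified

/-- Simple (unqualified) types. -/
abbrev STy : Type := Ty .simple

/-- Qualified types. -/
abbrev QTy : Type := Ty .qualified

/-- Renaming of the type variables (`ρ`) and the qualifier variables (`ξ`) of a type. -/
def Ty.rename : {k : Kind} → (ℕ → ℕ) → (ℕ → ℕ) → Ty k → Ty k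
  | _, _, _, .top => .top
  | _, ρ, _, .var X => .var (ρ X)
  | _, ρ, ξ, .arrow T₁ T₂ => .arrow (T₁.rename ρ ξ) (T₂.rename ρ ξ)
  | _, ρ, ξ, .all S T => .all (S.rename ρ ξ) (T.rename (liftRen ρ) ξ)
  | _, ρ, ξ, .qall Q T => .qall (Q.rename ξ) (T.rename ρ (liftRen ξ))
  | _, ρ, ξ, .qual Q S => .qual (Q.rename ξ) (S.rename ρ ξ)

/-- Weakening of a type by a new type variable. -/
def Ty.shiftTy {k : Kind} (T : Ty k) : Ty k := T.rename Nat.succ id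

/-- Weakening of a type by a new qualifier variable. -/
def Ty.shiftQual {k : Kind} (T : Ty k) : Ty k := T.rename id Nat.succ

/-- Extension of a type substitution below a type binder. -/
def Ty.lift (τ : ℕ → STy) : ℕ → STy
  | 0 => .var 0
  | n + 1 => (τ n).shiftTy

/-- Simultaneous capture-avoiding substitution of simple types for type variables (`τ`) and of
qualifiers for qualifier variables (`θ`) in a type. -/
def Ty.subst : {k : Kind} → (ℕ → STy) → (ℕ → Qual) → Ty k → Ty k
  | _, _, _, .top => .top
  | _, τ, _, .var X => τ X
  | _, τ, θ, .arrow T₁ T₂ => .arrow (T₁.subst τ θ) (T₂.subst τ θ)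
  | _, τ, θ, .all S T => .all (S.subst τ θ) (T.subst (Ty.lift τ) θ)
  | _, τ, θ, .qall Q T =>
      .qall (Q.subst θ) (T.subst (fun n => (τ n).shiftQual) (Qual.lift θ))
  | _, τ, θ, .qual Q S => .qual (Q.subst θ) (S.subst τ θ)

/-- The substitution that sends index `0` to `S` and lowers all other indices by one. -/
def Ty.single (S : STy) : ℕ → STy
  | 0 => S
  | n + 1 => .var n

/-- `T[X ↦ S]`, for the outermost type variable `X` (index `0`). -/
def Ty.instTy {k : Kind} (T : Ty k) (S : STy) : Ty k := T.subst (Ty.single S) Qual.var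

/-- `T[Y ↦ Q]`, for the outermost qualifier variable `Y` (index `0`). -/
def Ty.instQual {k : Kind} (T : Ty k) (Q : Qual) : Ty k := T.subst Ty.var (Qual.single Q)

/-! ### Terms -/

/-- Terms: variables `x`, abstractions `λ(x)_P. t`, `Λ(X <: S)_P. t`, `Λ(Y <: Q)_P. t` carrying a
qualifier tag `P`, the three forms of application `s(t)`, `s[S]`, `s{{Q}}`, and the two operations
on tags, `upqual P s` and `assert P s`. -/
inductive Tm : Type
  | var : ℕ → Tm
  | abs : Qual → Tm → Tm
  | app : Tm → Tm → Tm
  | tabs : Qual → STy → Tm → Tm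
  | tapp : Tm → STy → Tm
  | qabs : Qual → Qual → Tm → Tm
  | qapp : Tm → Qual → Tm
  | upqual : Qual → Tm → Tm
  | assert : Qual → Tm → Tm

/-- Renaming of the term (`χ`), type (`ρ`) and qualifier (`ξ`) variables of a term. -/
def Tm.rename : (ℕ → ℕ) → (ℕ → ℕ) → (ℕ → ℕ) → Tm → Tm
  | χ, _, _, .var x => .var (χ x)
  | χ, ρ, ξ, .abs P t => .abs (P.rename ξ) (t.rename (liftRen χ) ρ ξ)
  | χ, ρ, ξ, .app s t => .app (s.rename χ ρ ξ) (t.rename χ ρ ξ)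
  | χ, ρ, ξ, .tabs P S t => .tabs (P.rename ξ) (S.rename ρ ξ) (t.rename χ (liftRen ρ) ξ)
  | χ, ρ, ξ, .tapp s S => .tapp (s.rename χ ρ ξ) (S.rename ρ ξ)
  | χ, ρ, ξ, .qabs P Q t => .qabs (P.rename ξ) (Q.rename ξ) (t.rename χ ρ (liftRen ξ))
  | χ, ρ, ξ, .qapp s Q => .qapp (s.rename χ ρ ξ) (Q.rename ξ)
  | χ, ρ, ξ, .upqual P s => .upqual (P.rename ξ) (s.rename χ ρ ξ)
  | χ, ρ, ξ, .assert P s => .assert (P.rename ξ) (s.rename χ ρ ξ)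

/-- Extension of a term substitution below a term binder. -/
def Tm.lift (σ : ℕ → Tm) : ℕ → Tm
  | 0 => .var 0
  | n + 1 => (σ n).rename Nat.succ id id

/-- Simultaneous capture-avoiding substitution for the term (`σ`), type (`τ`) and qualifier (`θ`)
variables of a term. -/
def Tm.subst : (ℕ → Tm) → (ℕ → STy) → (ℕ → Qual) → Tm → Tm
  | σ, _, _, .var x => σ x
  | σ, τ, θ, .abs P t => .abs (P.subst θ) (t.subst (Tm.lift σ) τ θ)
  | σ, τ, θ, .app s t => .app (s.subst σ τ θ) (t.subst σ τ θ)
  | σ, τ, θ, .tabs P S t =>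
      .tabs (P.subst θ) (S.subst τ θ)
        (t.subst (fun n => (σ n).rename id Nat.succ id) (Ty.lift τ) θ)
  | σ, τ, θ, .tapp s S => .tapp (s.subst σ τ θ) (S.subst τ θ)
  | σ, τ, θ, .qabs P Q t =>
      .qabs (P.subst θ) (Q.subst θ)
        (t.subst (fun n => (σ n).rename id id Nat.succ) (fun n => (τ n).shiftQual) (Qual.lift θ))
  | σ, τ, θ, .qapp s Q => .qapp (s.subst σ τ θ) (Q.subst θ)
  | σ, τ, θ, .upqual P s => .upqual (P.subst θ) (s.subst σ τ θ)
  | σ, τ, θ, .assert P s => .assert (P.subst θ) (s.subst σ τ θ)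

/-- The substitution that sends index `0` to `s` and lowers all other indices by one. -/
def Tm.single (s : Tm) : ℕ → Tm
  | 0 => s
  | n + 1 => .var n

/-- `t[x ↦ s]`, for the outermost term variable `x` (index `0`). -/
def Tm.instTm (t s : Tm) : Tm := t.subst (Tm.single s) Ty.var Qual.var

/-- `t[X ↦ S]`, for the outermost type variable `X` (index `0`). -/
def Tm.instTy (t : Tm) (S : STy) : Tm := t.subst Tm.var (Ty.single S) Qual.var

/-- `t[Y ↦ Q]`, for the outermost qualifier variable `Y` (index `0`). -/
def Tm.instQual (t : Tm) (Q : Qual) : Tm := t.subst Tm.var Ty.var (Qual.single Q)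

/-! ### Reduction -/

/-- Values are the three forms of tagged abstraction. -/
inductive Value : Tm → Prop
  | abs (P : Qual) (t : Tm) : Value (.abs P t)
  | tabs (P : Qual) (S : STy) (t : Tm) : Value (.tabs P S t)
  | qabs (P Q : Qual) (t : Tm) : Value (.qabs P Q t)

/-- `HasTag v P`: `v` is a value with qualifier tag `P`. -/
inductive HasTag : Tm → Qual → Prop
  | abs (P : Qual) (t : Tm) : HasTag (.abs P t) P
  | tabs (P : Qual) (S : STy) (t : Tm) : HasTag (.tabs P S t) P
  | qabs (P Q : Qual) (t : Tm) : HasTag (.qabs P Q t) P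

/-- Replacement of the tag of a value by `R`; other terms are left alone. -/
def Tm.retag (R : Qual) : Tm → Tm
  | .abs _ t => .abs R t
  | .tabs _ S t => .tabs R S t
  | .qabs _ Q t => .qabs R Q t
  | t => t

/-- `P` and `R` denote concrete qualifiers, and that of `P` is at most that of `R`. -/
def EvalLE (P R : Qual) : Prop :=
  ∃ c d : Bool, P.eval = some c ∧ R.eval = some d ∧ c ≤ d

/-- Call-by-value small-step reduction `s ⟶ t`. -/
inductive Step : Tm → Tm → Prop
  | beta_v (P : Qual) (t v : Tm) :
      Value v → Step (.app (.abs P t) v) (t.instTm v)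
  | beta_T (P : Qual) (S : STy) (t : Tm) (S' : STy) :
      Step (.tapp (.tabs P S t) S') (t.instTy S')
  | beta_Q (P Q : Qual) (t : Tm) (Q' : Qual) :
      Step (.qapp (.qabs P Q t) Q') (t.instQual Q')
  | upqual (P R : Qual) (v : Tm) :
      HasTag v P → EvalLE P R → Step (.upqual R v) (v.retag R)
  | assert (P R : Qual) (v : Tm) :
      HasTag v P → EvalLE P R → Step (.assert R v) v
  | app_fun (s s' t : Tm) : Step s s' → Step (.app s t) (.app s' t)
  | app_arg (v t t' : Tm) : Value v → Step t t' → Step (.app v t) (.app v t')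
  | tapp_congr (s s' : Tm) (S : STy) : Step s s' → Step (.tapp s S) (.tapp s' S)
  | qapp_congr (s s' : Tm) (Q : Qual) : Step s s' → Step (.qapp s Q) (.qapp s' Q)
  | upqual_congr (P : Qual) (s s' : Tm) : Step s s' → Step (.upqual P s) (.upqual P s')
  | assert_congr (P : Qual) (s s' : Tm) : Step s s' → Step (.assert P s) (.assert P s')

/-! ### Environments -/

/-- Bindings `x : T`, `X <: S` and `Y <: Q`. -/
inductive Binding : Type
  | tm : QTy → Binding
  | ty : STy → Binding
  | qu : Qual → Binding

/-- Environments `Γ`, most recent binding first; each binding refers to the variables bound in the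
tail that follows it. -/
abbrev Env : Type := List Binding

/-- `x : T ∈ Γ`, with `T` weakened to all of `Γ`. -/
inductive HasTm : Env → ℕ → QTy → Prop
  | here (Γ : Env) (T : QTy) : HasTm (.tm T :: Γ) 0 T
  | tm (Γ : Env) (T' : QTy) (x : ℕ) (T : QTy) : HasTm Γ x T → HasTm (.tm T' :: Γ) (x + 1) T
  | ty (Γ : Env) (S' : STy) (x : ℕ) (T : QTy) : HasTm Γ x T → HasTm (.ty S' :: Γ) x T.shiftTy
  | qu (Γ : Env) (Q' : Qual) (x : ℕ) (T : QTy) : HasTm Γ x T → HasTm (.qu Q' :: Γ) x T.shiftQual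

/-- `X <: S ∈ Γ`, with `S` weakened to all of `Γ`. -/
inductive HasTy : Env → ℕ → STy → Prop
  | here (Γ : Env) (S : STy) : HasTy (.ty S :: Γ) 0 S.shiftTy
  | tm (Γ : Env) (T' : QTy) (X : ℕ) (S : STy) : HasTy Γ X S → HasTy (.tm T' :: Γ) X S
  | ty (Γ : Env) (S' : STy) (X : ℕ) (S : STy) :
      HasTy Γ X S → HasTy (.ty S' :: Γ) (X + 1) S.shiftTy
  | qu (Γ : Env) (Q' : Qual) (X : ℕ) (S : STy) : HasTy Γ X S → HasTy (.qu Q' :: Γ) X S.shiftQual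

/-- `Y <: Q ∈ Γ`, with `Q` weakened to all of `Γ`. -/
inductive HasQu : Env → ℕ → Qual → Prop
  | here (Γ : Env) (Q : Qual) : HasQu (.qu Q :: Γ) 0 (Q.rename Nat.succ)
  | tm (Γ : Env) (T' : QTy) (Y : ℕ) (Q : Qual) : HasQu Γ Y Q → HasQu (.tm T' :: Γ) Y Q
  | ty (Γ : Env) (S' : STy) (Y : ℕ) (Q : Qual) : HasQu Γ Y Q → HasQu (.ty S' :: Γ) Y Q
  | qu (Γ : Env) (Q' : Qual) (Y : ℕ) (Q : Qual) :
      HasQu Γ Y Q → HasQu (.qu Q' :: Γ) (Y + 1) (Q.rename Nat.succ)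

/-! ### Well-formedness: all variables are bound in the environment -/

/-- Well-formed qualifiers. -/
inductive WfQual (Γ : Env) : Qual → Prop
  | top : WfQual Γ .top
  | bot : WfQual Γ .bot
  | var (Y : ℕ) (Q : Qual) : HasQu Γ Y Q → WfQual Γ (.var Y)
  | meet (Q R : Qual) : WfQual Γ Q → WfQual Γ R → WfQual Γ (.meet Q R)
  | join (Q R : Qual) : WfQual Γ Q → WfQual Γ R → WfQual Γ (.join Q R)

/-- Well-formed (simple or qualified) types. -/
inductive WfTy : {k : Kind} → Env → Ty k → Prop
  | top (Γ : Env) : WfTy Γ .top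
  | var (Γ : Env) (X : ℕ) (S : STy) : HasTy Γ X S → WfTy Γ (.var X)
  | arrow (Γ : Env) (T₁ T₂ : QTy) : WfTy Γ T₁ → WfTy Γ T₂ → WfTy Γ (.arrow T₁ T₂)
  | all (Γ : Env) (S : STy) (T : QTy) :
      WfTy Γ S → WfTy (.ty S :: Γ) T → WfTy Γ (.all S T)
  | qall (Γ : Env) (Q : Qual) (T : QTy) :
      WfQual Γ Q → WfTy (.qu Q :: Γ) T → WfTy Γ (.qall Q T)
  | qual (Γ : Env) (Q : Qual) (S : STy) : WfQual Γ Q → WfTy Γ S → WfTy Γ (.qual Q S)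

/-- Well-formed environments. -/
inductive WfEnv : Env → Prop
  | nil : WfEnv []
  | tm (Γ : Env) (T : QTy) : WfEnv Γ → WfTy Γ T → WfEnv (.tm T :: Γ)
  | ty (Γ : Env) (S : STy) : WfEnv Γ → WfTy Γ S → WfEnv (.ty S :: Γ)
  | qu (Γ : Env) (Q : Qual) : WfEnv Γ → WfQual Γ Q → WfEnv (.qu Q :: Γ)

/-! ### Subqualification, subtyping, typing

The axioms of each judgement require a well-formed environment, and the rules require those parts of
the conclusion to be well-formed that no premise mentions. -/

/-- Subqualification `Γ ⊢ Q <: R`. -/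
inductive SubQual (Γ : Env) : Qual → Qual → Prop
  | top (Q : Qual) : WfEnv Γ → WfQual Γ Q → SubQual Γ Q .top
  | bot (Q : Qual) : WfEnv Γ → WfQual Γ Q → SubQual Γ .bot Q
  | refl_var (Y : ℕ) : WfEnv Γ → WfQual Γ (.var Y) → SubQual Γ (.var Y) (.var Y)
  | var (Y : ℕ) (Q R : Qual) : HasQu Γ Y Q → SubQual Γ Q R → SubQual Γ (.var Y) R
  | join_intro_1 (Q R₁ R₂ : Qual) :
      SubQual Γ Q R₁ → WfQual Γ R₂ → SubQual Γ Q (.join R₁ R₂)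
  | join_intro_2 (Q R₁ R₂ : Qual) :
      WfQual Γ R₁ → SubQual Γ Q R₂ → SubQual Γ Q (.join R₁ R₂)
  | join_elim (Q₁ Q₂ R : Qual) :
      SubQual Γ Q₁ R → SubQual Γ Q₂ R → SubQual Γ (.join Q₁ Q₂) R
  | meet_elim_1 (Q₁ Q₂ R : Qual) :
      SubQual Γ Q₁ R → WfQual Γ Q₂ → SubQual Γ (.meet Q₁ Q₂) R
  | meet_elim_2 (Q₁ Q₂ R : Qual) :
      WfQual Γ Q₁ → SubQual Γ Q₂ R → SubQual Γ (.meet Q₁ Q₂) R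
  | meet_intro (Q R₁ R₂ : Qual) :
      SubQual Γ Q R₁ → SubQual Γ Q R₂ → SubQual Γ Q (.meet R₁ R₂)

/-- Subtyping `Γ ⊢ S₁ <: S₂` of simple types and `Γ ⊢ T₁ <: T₂` of qualified types. -/
inductive Sub : {k : Kind} → Env → Ty k → Ty k → Prop
  | top (Γ : Env) (S : STy) : WfEnv Γ → WfTy Γ S → Sub Γ S .top
  | refl_var (Γ : Env) (X : ℕ) :
      WfEnv Γ → WfTy Γ (.var X) → Sub Γ (.var X) (.var X)
  | var (Γ : Env) (X : ℕ) (S S' : STy) : HasTy Γ X S → Sub Γ S S' → Sub Γ (.var X) S'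
  | arrow (Γ : Env) (T₁ T₂ U₁ U₂ : QTy) :
      Sub Γ U₁ T₁ → Sub Γ T₂ U₂ → Sub Γ (.arrow T₁ T₂) (.arrow U₁ U₂)
  | all (Γ : Env) (S₁ S₂ : STy) (T₁ T₂ : QTy) :
      Sub Γ S₂ S₁ → Sub (.ty S₂ :: Γ) T₁ T₂ → Sub Γ (.all S₁ T₁) (.all S₂ T₂)
  | qall (Γ : Env) (Q₁ Q₂ : Qual) (T₁ T₂ : QTy) :
      SubQual Γ Q₂ Q₁ → Sub (.qu Q₂ :: Γ) T₁ T₂ → Sub Γ (.qall Q₁ T₁) (.qall Q₂ T₂)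
  | qtype (Γ : Env) (Q₁ Q₂ : Qual) (S₁ S₂ : STy) :
      SubQual Γ Q₁ Q₂ → Sub Γ S₁ S₂ → Sub Γ (.qual Q₁ S₁) (.qual Q₂ S₂)

/-- Typing `Γ ⊢ t : T`. -/
inductive Typing : Env → Tm → QTy → Prop
  | var (Γ : Env) (x : ℕ) (T : QTy) : WfEnv Γ → HasTm Γ x T → Typing Γ (.var x) T
  | abs (Γ : Env) (P : Qual) (t : Tm) (T₁ T₂ : QTy) :
      WfQual Γ P → Typing (.tm T₁ :: Γ) t T₂ →
      Typing Γ (.abs P t) (.qual P (.arrow T₁ T₂))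
  | t_abs (Γ : Env) (P : Qual) (S : STy) (t : Tm) (T : QTy) :
      WfQual Γ P → Typing (.ty S :: Γ) t T →
      Typing Γ (.tabs P S t) (.qual P (.all S T))
  | q_abs (Γ : Env) (P Q : Qual) (t : Tm) (T : QTy) :
      WfQual Γ P → Typing (.qu Q :: Γ) t T →
      Typing Γ (.qabs P Q t) (.qual P (.qall Q T))
  | app (Γ : Env) (Q : Qual) (s t : Tm) (T₁ T₂ : QTy) :
      Typing Γ s (.qual Q (.arrow T₁ T₂)) → Typing Γ t T₁ → Typing Γ (.app s t) T₂
  | t_app (Γ : Env) (Q : Qual) (s : Tm) (S S' : STy) (T : QTy) :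
      Typing Γ s (.qual Q (.all S T)) → Sub Γ S' S → Typing Γ (.tapp s S') (T.instTy S')
  | q_app (Γ : Env) (R : Qual) (s : Tm) (Q Q' : Qual) (T : QTy) :
      Typing Γ s (.qual R (.qall Q T)) → SubQual Γ Q' Q → Typing Γ (.qapp s Q') (T.instQual Q')
  | typ_assert (Γ : Env) (P Q : Qual) (s : Tm) (S : STy) :
      Typing Γ s (.qual Q S) → SubQual Γ Q P → Typing Γ (.assert P s) (.qual Q S)
  | typ_upqual (Γ : Env) (P Q : Qual) (s : Tm) (S : STy) :
      Typing Γ s (.qual Q S) → SubQual Γ Q P → Typing Γ (.upqual P s) (.qual P S)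
  | sub (Γ : Env) (s : Tm) (T₁ T₂ : QTy) :
      Typing Γ s T₁ → Sub Γ T₁ T₂ → Typing Γ s T₂

end FsubQ

/-!
Preservation goes by induction on typing. A β-redex is handled by inverting the typing of the
abstraction and applying the substitution lemma for the variable that it binds. Inversion has to
collapse a chain of subsumptions, so it rests on transitivity of subtyping, which is not a rule of
the calculus.

Transitivity through `B` is proved by induction on `B`. At `B = ∀(X <: S). T` it needs narrowing,
the replacement of the bound `S` of `X` by a subtype, and narrowing in turn needs transitivity
through `S`, in all environments that extend the given one. Narrowing is substitution along the
identity, so a single substitution lemma for subtyping serves both purposes, provided that it asks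
for transitivity only through the bounds that the substitution really moves.
-/

namespace FsubQ

variable {k : Kind} {Γ Δ : Env} {χ ρ ξ : ℕ → ℕ} {σ : ℕ → Tm} {τ : ℕ → STy} {θ : ℕ → Qual}
  {P Q Q' R : Qual} {S S' : STy} {t v : Tm}

/-! ### Renaming and substitution -/

theorem liftRen_id : liftRen id = id := by
  funext n; cases n <;> rfl

theorem liftRen_comp_liftRen (ξ ζ : ℕ → ℕ) : liftRen ζ ∘ liftRen ξ = liftRen (ζ ∘ ξ) := by
  funext n; cases n <;> rfl

namespace Qual

theorem rename_id (Q : Qual) : Q.rename id = Q := by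
  induction Q <;> simp_all [rename]

theorem rename_rename (Q : Qual) (ξ ζ : ℕ → ℕ) : (Q.rename ξ).rename ζ = Q.rename (ζ ∘ ξ) := by
  induction Q <;> simp_all [rename]

theorem subst_var (Q : Qual) : Q.subst var = Q := by
  induction Q <;> simp_all [subst]

theorem subst_rename (Q : Qual) (ξ : ℕ → ℕ) (θ : ℕ → Qual) :
    (Q.rename ξ).subst θ = Q.subst (θ ∘ ξ) := by
  induction Q <;> simp_all [rename, subst]

theorem rename_subst (Q : Qual) (θ : ℕ → Qual) (ξ : ℕ → ℕ) :
    (Q.subst θ).rename ξ = Q.subst fun n ↦ (θ n).rename ξ := by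
  induction Q <;> simp_all [rename, subst]

theorem subst_subst (Q : Qual) (θ η : ℕ → Qual) :
    (Q.subst θ).subst η = Q.subst fun n ↦ (θ n).subst η := by
  induction Q <;> simp_all [subst]

theorem rename_rename_succ (Q : Qual) (ξ : ℕ → ℕ) :
    (Q.rename Nat.succ).rename (liftRen ξ) = (Q.rename ξ).rename Nat.succ := by
  rw [rename_rename, rename_rename]; rfl

theorem subst_rename_succ (Q : Qual) (θ : ℕ → Qual) :
    (Q.rename Nat.succ).subst (lift θ) = (Q.subst θ).rename Nat.succ := by
  rw [subst_rename, rename_subst]; rfl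

theorem subst_single_rename_succ (Q R : Qual) : (Q.rename Nat.succ).subst (single R) = Q := by
  rw [subst_rename]; exact subst_var Q

theorem lift_var : lift var = var := by
  funext n; cases n <;> rfl

theorem lift_liftRen (θ : ℕ → Qual) (ξ : ℕ → ℕ) :
    (fun n ↦ lift θ (liftRen ξ n)) = lift fun n ↦ θ (ξ n) := by
  funext n; cases n <;> rfl

theorem rename_lift (θ : ℕ → Qual) (ξ : ℕ → ℕ) :
    (fun n ↦ (lift θ n).rename (liftRen ξ)) = lift fun n ↦ (θ n).rename ξ := by
  funext n
  cases n with
  | zero => rfl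
  | succ n => exact rename_rename_succ _ _

theorem subst_lift (θ η : ℕ → Qual) :
    (fun n ↦ (lift θ n).subst (lift η)) = lift fun n ↦ (θ n).subst η := by
  funext n
  cases n with
  | zero => rfl
  | succ n => exact subst_rename_succ _ _

end Qual

namespace Ty

theorem rename_id (T : Ty k) : T.rename id id = T := by
  induction T <;> simp_all [rename, liftRen_id, Qual.rename_id]

theorem rename_rename (T : Ty k) (ρ ξ ρ' ξ' : ℕ → ℕ) :
    (T.rename ρ ξ).rename ρ' ξ' = T.rename (ρ' ∘ ρ) (ξ' ∘ ξ) := by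
  induction T generalizing ρ ξ ρ' ξ' <;>
    simp_all [rename, liftRen_comp_liftRen, Qual.rename_rename]

theorem rename_shiftTy (T : Ty k) (ρ ξ : ℕ → ℕ) :
    T.shiftTy.rename (liftRen ρ) ξ = (T.rename ρ ξ).shiftTy := by
  rw [shiftTy, shiftTy, rename_rename, rename_rename]; rfl

theorem rename_shiftQual (T : Ty k) (ρ ξ : ℕ → ℕ) :
    T.shiftQual.rename ρ (liftRen ξ) = (T.rename ρ ξ).shiftQual := by
  rw [shiftQual, shiftQual, rename_rename, rename_rename]; rfl

theorem lift_var : lift var = var := by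
  funext n; cases n <;> rfl

theorem lift_liftRen (τ : ℕ → STy) (ρ : ℕ → ℕ) :
    (fun n ↦ lift τ (liftRen ρ n)) = lift fun n ↦ τ (ρ n) := by
  funext n; cases n <;> rfl

theorem rename_lift (τ : ℕ → STy) (ρ ξ : ℕ → ℕ) :
    (fun n ↦ (lift τ n).rename (liftRen ρ) ξ) = lift fun n ↦ (τ n).rename ρ ξ := by
  funext n
  cases n with
  | zero => rfl
  | succ n => exact rename_shiftTy _ _ _

theorem subst_var (T : Ty k) : T.subst var Qual.var = T := by
  induction T <;>
    simp_all [subst, lift_var, Qual.lift_var, Qual.subst_var, shiftQual, rename]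

theorem subst_rename (T : Ty k) (ρ ξ : ℕ → ℕ) (τ : ℕ → STy) (θ : ℕ → Qual) :
    (T.rename ρ ξ).subst τ θ = T.subst (τ ∘ ρ) (θ ∘ ξ) := by
  induction T generalizing ρ ξ τ θ <;>
    simp_all [rename, subst, lift_liftRen, Qual.lift_liftRen, Qual.subst_rename,
      Function.comp_def]

theorem rename_subst (T : Ty k) (τ : ℕ → STy) (θ : ℕ → Qual) (ρ ξ : ℕ → ℕ) :
    (T.subst τ θ).rename ρ ξ = T.subst (fun n ↦ (τ n).rename ρ ξ) fun n ↦ (θ n).rename ξ := by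
  induction T generalizing τ θ ρ ξ <;>
    simp_all [rename, subst, rename_lift, Qual.rename_lift, Qual.rename_subst, rename_shiftQual]

theorem subst_shiftTy (T : Ty k) (τ : ℕ → STy) (θ : ℕ → Qual) :
    T.shiftTy.subst (lift τ) θ = (T.subst τ θ).shiftTy := by
  simp only [shiftTy, subst_rename, rename_subst, Qual.rename_id]; rfl

theorem subst_shiftQual (T : Ty k) (τ : ℕ → STy) (θ : ℕ → Qual) :
    T.shiftQual.subst (fun n ↦ (τ n).shiftQual) (Qual.lift θ) = (T.subst τ θ).shiftQual := by
  simp only [shiftQual, subst_rename, rename_subst]; rfl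

theorem subst_lift (τ τ' : ℕ → STy) (θ : ℕ → Qual) :
    (fun n ↦ (lift τ n).subst (lift τ') θ) = lift fun n ↦ (τ n).subst τ' θ := by
  funext n
  cases n with
  | zero => rfl
  | succ n => exact subst_shiftTy _ _ _

theorem subst_subst (T : Ty k) (τ τ' : ℕ → STy) (θ θ' : ℕ → Qual) :
    (T.subst τ θ).subst τ' θ' =
      T.subst (fun n ↦ (τ n).subst τ' θ') fun n ↦ (θ n).subst θ' := by
  induction T generalizing τ τ' θ θ' <;>
    simp_all [subst, subst_lift, Qual.subst_lift, Qual.subst_subst, subst_shiftQual]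

theorem instTy_shiftTy (T : Ty k) (S : STy) : T.shiftTy.instTy S = T := by
  rw [shiftTy, instTy, subst_rename]; exact subst_var T

theorem instQual_shiftQual (T : Ty k) (Q : Qual) : T.shiftQual.instQual Q = T := by
  rw [shiftQual, instQual, subst_rename]; exact subst_var T

theorem rename_instTy (T : Ty k) (S : STy) (ρ ξ : ℕ → ℕ) :
    (T.instTy S).rename ρ ξ = (T.rename (liftRen ρ) ξ).instTy (S.rename ρ ξ) := by
  rw [instTy, instTy, rename_subst, subst_rename]
  congr 1
  funext n; cases n <;> rfl

theorem rename_instQual (T : Ty k) (Q : Qual) (ρ ξ : ℕ → ℕ) :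
    (T.instQual Q).rename ρ ξ = (T.rename ρ (liftRen ξ)).instQual (Q.rename ξ) := by
  rw [instQual, instQual, rename_subst, subst_rename]
  congr 1
  funext n; cases n <;> rfl

theorem subst_instTy (T : Ty k) (S : STy) (τ : ℕ → STy) (θ : ℕ → Qual) :
    (T.instTy S).subst τ θ = (T.subst (lift τ) θ).instTy (S.subst τ θ) := by
  simp only [instTy, subst_subst, Qual.subst_var]
  congr 1
  funext n
  cases n with
  | zero => rfl
  | succ n => exact (instTy_shiftTy _ _).symm

theorem subst_instQual (T : Ty k) (Q : Qual) (τ : ℕ → STy) (θ : ℕ → Qual) :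
    (T.instQual Q).subst τ θ =
      (T.subst (fun n ↦ (τ n).shiftQual) (Qual.lift θ)).instQual (Q.subst θ) := by
  simp only [instQual, subst_subst]
  congr 1
  · funext n
    exact (instQual_shiftQual _ _).symm
  · funext n
    cases n with
    | zero => rfl
    | succ n => exact (Qual.subst_single_rename_succ _ _).symm

end Ty

/-! ### Well-formedness -/

/-- A renaming of the type and qualifier variables of `Γ` by variables of `Δ` with the same bounds.
It carries subqualification and subtyping in `Γ` over to `Δ`. -/
structure BoundRen (Δ Γ : Env) (ρ ξ : ℕ → ℕ) : Prop where
  ty : ∀ {X S}, HasTy Γ X S → HasTy Δ (ρ X) (S.rename ρ ξ)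
  qu : ∀ {Y Q}, HasQu Γ Y Q → HasQu Δ (ξ Y) (Q.rename ξ)

namespace BoundRen

theorem consTm (h : BoundRen Δ Γ ρ ξ) (T T' : QTy) : BoundRen (.tm T' :: Δ) (.tm T :: Γ) ρ ξ where
  ty | .tm _ _ _ _ hX => .tm _ _ _ _ (h.ty hX)
  qu | .tm _ _ _ _ hY => .tm _ _ _ _ (h.qu hY)

theorem consTy (h : BoundRen Δ Γ ρ ξ) (S : STy) :
    BoundRen (.ty (S.rename ρ ξ) :: Δ) (.ty S :: Γ) (liftRen ρ) ξ where
  ty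
    | .here _ _ => by rw [Ty.rename_shiftTy]; exact .here _ _
    | .ty _ _ _ _ hX => by rw [Ty.rename_shiftTy]; exact .ty _ _ _ _ (h.ty hX)
  qu | .ty _ _ _ _ hY => .ty _ _ _ _ (h.qu hY)

theorem consQu (h : BoundRen Δ Γ ρ ξ) (Q : Qual) :
    BoundRen (.qu (Q.rename ξ) :: Δ) (.qu Q :: Γ) ρ (liftRen ξ) where
  ty | .qu _ _ _ _ hX => by rw [Ty.rename_shiftQual]; exact .qu _ _ _ _ (h.ty hX)
  qu
    | .here _ _ => by rw [Qual.rename_rename_succ]; exact .here _ _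
    | .qu _ _ _ _ hY => by rw [Qual.rename_rename_succ]; exact .qu _ _ _ _ (h.qu hY)

theorem shiftTm (Γ : Env) (T : QTy) : BoundRen (.tm T :: Γ) Γ id id where
  ty hX := by rw [Ty.rename_id]; exact .tm _ _ _ _ hX
  qu hY := by rw [Qual.rename_id]; exact .tm _ _ _ _ hY

theorem shiftTy (Γ : Env) (S : STy) : BoundRen (.ty S :: Γ) Γ Nat.succ id where
  ty hX := .ty _ _ _ _ hX
  qu hY := by rw [Qual.rename_id]; exact .ty _ _ _ _ hY

theorem shiftQual (Γ : Env) (Q : Qual) : BoundRen (.qu Q :: Γ) Γ id Nat.succ where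
  ty hX := .qu _ _ _ _ hX
  qu hY := .qu _ _ _ _ hY

end BoundRen

theorem WfQual.rename (hQ : WfQual Γ Q) (h : BoundRen Δ Γ ρ ξ) : WfQual Δ (Q.rename ξ) := by
  induction hQ with
  | top => exact .top
  | bot => exact .bot
  | var _ _ hY => exact .var _ _ (h.qu hY)
  | meet _ _ _ _ ih₁ ih₂ => exact .meet _ _ ih₁ ih₂
  | join _ _ _ _ ih₁ ih₂ => exact .join _ _ ih₁ ih₂

theorem WfTy.rename {T : Ty k} (hT : WfTy Γ T) (h : BoundRen Δ Γ ρ ξ) :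
    WfTy Δ (T.rename ρ ξ) := by
  induction hT generalizing Δ ρ ξ with
  | top => exact .top _
  | var _ _ _ hX => exact .var _ _ _ (h.ty hX)
  | arrow _ _ _ _ _ ih₁ ih₂ => exact .arrow _ _ _ (ih₁ h) (ih₂ h)
  | all _ _ _ _ _ ih₁ ih₂ => exact .all _ _ _ (ih₁ h) (ih₂ (h.consTy _))
  | qall _ _ _ hQ _ ih => exact .qall _ _ _ (hQ.rename h) (ih (h.consQu _))
  | qual _ _ _ hQ _ ih => exact .qual _ _ _ (hQ.rename h) (ih h)

/-- A substitution for the type and qualifier variables of `Γ` by types and qualifiers that are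
well-formed in `Δ`, whatever the bounds. -/
structure WfSubst (Δ Γ : Env) (τ : ℕ → STy) (θ : ℕ → Qual) : Prop where
  ty : ∀ {X S}, HasTy Γ X S → WfTy Δ (τ X)
  qu : ∀ {Y Q}, HasQu Γ Y Q → WfQual Δ (θ Y)

namespace WfSubst

theorem consTy (h : WfSubst Δ Γ τ θ) (S S' : STy) :
    WfSubst (.ty S' :: Δ) (.ty S :: Γ) (Ty.lift τ) θ where
  ty
    | .here _ _ => .var _ _ _ (.here _ _)
    | .ty _ _ _ _ hX => (h.ty hX).rename (.shiftTy _ _)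
  qu | .ty _ _ _ _ hY => by simpa only [Qual.rename_id] using (h.qu hY).rename (.shiftTy _ _)

theorem consQu (h : WfSubst Δ Γ τ θ) (Q Q' : Qual) :
    WfSubst (.qu Q' :: Δ) (.qu Q :: Γ) (fun n ↦ (τ n).shiftQual) (Qual.lift θ) where
  ty | .qu _ _ _ _ hX => (h.ty hX).rename (.shiftQual _ _)
  qu
    | .here _ _ => .var _ _ (.here _ _)
    | .qu _ _ _ _ hY => (h.qu hY).rename (.shiftQual _ _)

theorem dropTm (Γ : Env) (T : QTy) : WfSubst Γ (.tm T :: Γ) .var .var where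
  ty | .tm _ _ _ _ hX => .var _ _ _ hX
  qu | .tm _ _ _ _ hY => .var _ _ hY

theorem changeTy (Γ : Env) (S S' : STy) : WfSubst (.ty S' :: Γ) (.ty S :: Γ) .var .var where
  ty
    | .here _ _ => .var _ _ _ (.here _ _)
    | .ty _ _ _ _ hX => .var _ _ _ (.ty _ _ _ _ hX)
  qu | .ty _ _ _ _ hY => .var _ _ (.ty _ _ _ _ hY)

theorem changeQu (Γ : Env) (Q Q' : Qual) : WfSubst (.qu Q' :: Γ) (.qu Q :: Γ) .var .var where
  ty | .qu _ _ _ _ hX => .var _ _ _ (.qu _ _ _ _ hX)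
  qu
    | .here _ _ => .var _ _ (.here _ _)
    | .qu _ _ _ _ hY => .var _ _ (.qu _ _ _ _ hY)

theorem singleTy (hS : WfTy Γ S') (S : STy) : WfSubst Γ (.ty S :: Γ) (.single S') .var where
  ty
    | .here _ _ => hS
    | .ty _ _ _ _ hX => .var _ _ _ hX
  qu | .ty _ _ _ _ hY => .var _ _ hY

theorem singleQual (hQ : WfQual Γ Q') (Q : Qual) : WfSubst Γ (.qu Q :: Γ) .var (.single Q') where
  ty | .qu _ _ _ _ hX => .var _ _ _ hX
  qu
    | .here _ _ => hQ
    | .qu _ _ _ _ hY => .var _ _ hY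

end WfSubst

theorem WfQual.subst (hQ : WfQual Γ Q) (h : WfSubst Δ Γ τ θ) : WfQual Δ (Q.subst θ) := by
  induction hQ with
  | top => exact .top
  | bot => exact .bot
  | var _ _ hY => exact h.qu hY
  | meet _ _ _ _ ih₁ ih₂ => exact .meet _ _ ih₁ ih₂
  | join _ _ _ _ ih₁ ih₂ => exact .join _ _ ih₁ ih₂

theorem WfTy.subst {T : Ty k} (hT : WfTy Γ T) (h : WfSubst Δ Γ τ θ) : WfTy Δ (T.subst τ θ) := by
  induction hT generalizing Δ τ θ with
  | top => exact .top _
  | var _ _ _ hX => exact h.ty hX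
  | arrow _ _ _ _ _ ih₁ ih₂ => exact .arrow _ _ _ (ih₁ h) (ih₂ h)
  | all _ _ _ _ _ ih₁ ih₂ => exact .all _ _ _ (ih₁ h) (ih₂ (h.consTy _ _))
  | qall _ _ _ hQ _ ih => exact .qall _ _ _ (hQ.subst h) (ih (h.consQu _ _))
  | qual _ _ _ hQ _ ih => exact .qual _ _ _ (hQ.subst h) (ih h)

theorem WfTy.of_wfSubst_var {T : Ty k} (hT : WfTy Γ T) (h : WfSubst Δ Γ .var .var) : WfTy Δ T := by
  simpa only [Ty.subst_var] using hT.subst h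

theorem WfEnv.tail {b : Binding} : WfEnv (b :: Γ) → WfEnv Γ
  | .tm _ _ h _ | .ty _ _ h _ | .qu _ _ h _ => h

theorem WfEnv.head_tm {T : QTy} : WfEnv (.tm T :: Γ) → WfTy Γ T
  | .tm _ _ _ h => h

theorem WfEnv.head_ty : WfEnv (.ty S :: Γ) → WfTy Γ S
  | .ty _ _ _ h => h

theorem WfEnv.head_qu : WfEnv (.qu Q :: Γ) → WfQual Γ Q
  | .qu _ _ _ h => h

theorem HasTm.wfTy {x : ℕ} {T : QTy} (h : HasTm Γ x T) (hΓ : WfEnv Γ) : WfTy Γ T := by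
  induction h with
  | here => simpa only [Ty.rename_id] using hΓ.head_tm.rename (.shiftTm _ _)
  | tm _ _ _ _ _ ih => simpa only [Ty.rename_id] using (ih hΓ.tail).rename (.shiftTm _ _)
  | ty _ _ _ _ _ ih => exact (ih hΓ.tail).rename (.shiftTy _ _)
  | qu _ _ _ _ _ ih => exact (ih hΓ.tail).rename (.shiftQual _ _)

theorem HasQu.wfQual {Y : ℕ} (h : HasQu Γ Y Q) (hΓ : WfEnv Γ) : WfQual Γ Q := by
  induction h with
  | here => exact hΓ.head_qu.rename (.shiftQual _ _)
  | tm _ _ _ _ _ ih => simpa only [Qual.rename_id] using (ih hΓ.tail).rename (.shiftTm _ _)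
  | ty _ _ _ _ _ ih => simpa only [Qual.rename_id] using (ih hΓ.tail).rename (.shiftTy _ _)
  | qu _ _ _ _ _ ih => exact (ih hΓ.tail).rename (.shiftQual _ _)

/-! ### Subqualification -/

theorem SubQual.wf (h : SubQual Γ Q R) : WfEnv Γ ∧ WfQual Γ Q ∧ WfQual Γ R := by
  induction h with
  | top _ hΓ hQ => exact ⟨hΓ, hQ, .top⟩
  | bot _ hΓ hQ => exact ⟨hΓ, .bot, hQ⟩
  | refl_var _ hΓ hY => exact ⟨hΓ, hY, hY⟩
  | var _ _ _ hY _ ih => exact ⟨ih.1, .var _ _ hY, ih.2.2⟩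
  | join_intro_1 _ _ _ _ hR ih => exact ⟨ih.1, ih.2.1, .join _ _ ih.2.2 hR⟩
  | join_intro_2 _ _ _ hR _ ih => exact ⟨ih.1, ih.2.1, .join _ _ hR ih.2.2⟩
  | join_elim _ _ _ _ _ ih₁ ih₂ => exact ⟨ih₁.1, .join _ _ ih₁.2.1 ih₂.2.1, ih₁.2.2⟩
  | meet_elim_1 _ _ _ _ hQ ih => exact ⟨ih.1, .meet _ _ ih.2.1 hQ, ih.2.2⟩
  | meet_elim_2 _ _ _ hQ _ ih => exact ⟨ih.1, .meet _ _ hQ ih.2.1, ih.2.2⟩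
  | meet_intro _ _ _ _ _ ih₁ ih₂ => exact ⟨ih₁.1, ih₁.2.1, .meet _ _ ih₁.2.2 ih₂.2.2⟩

theorem SubQual.wfEnv (h : SubQual Γ Q R) : WfEnv Γ := h.wf.1

theorem SubQual.wf_left (h : SubQual Γ Q R) : WfQual Γ Q := h.wf.2.1

theorem SubQual.wf_right (h : SubQual Γ Q R) : WfQual Γ R := h.wf.2.2

theorem SubQual.refl (hΓ : WfEnv Γ) (hQ : WfQual Γ Q) : SubQual Γ Q Q := by
  induction hQ with
  | top => exact .top _ hΓ .top
  | bot => exact .bot _ hΓ .bot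
  | var _ _ hY => exact .refl_var _ hΓ (.var _ _ hY)
  | meet _ _ hQ hR ihQ ihR =>
    exact .meet_intro _ _ _ (.meet_elim_1 _ _ _ ihQ hR) (.meet_elim_2 _ _ _ hQ ihR)
  | join _ _ hQ hR ihQ ihR =>
    exact .join_elim _ _ _ (.join_intro_1 _ _ _ ihQ hR) (.join_intro_2 _ _ _ hQ ihR)

theorem HasQu.subQual {Y : ℕ} (h : HasQu Γ Y Q) (hΓ : WfEnv Γ) : SubQual Γ (.var Y) Q :=
  .var _ _ _ h (.refl hΓ (h.wfQual hΓ))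

theorem SubQual.rename (h : SubQual Γ Q R) (hΔ : WfEnv Δ) (hr : BoundRen Δ Γ ρ ξ) :
    SubQual Δ (Q.rename ξ) (R.rename ξ) := by
  induction h with
  | top _ _ hQ => exact .top _ hΔ (hQ.rename hr)
  | bot _ _ hQ => exact .bot _ hΔ (hQ.rename hr)
  | refl_var _ _ hY => exact .refl_var _ hΔ (hY.rename hr)
  | var _ _ _ hY _ ih => exact .var _ _ _ (hr.qu hY) ih
  | join_intro_1 _ _ _ _ hR ih => exact .join_intro_1 _ _ _ ih (hR.rename hr)
  | join_intro_2 _ _ _ hR _ ih => exact .join_intro_2 _ _ _ (hR.rename hr) ih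
  | join_elim _ _ _ _ _ ih₁ ih₂ => exact .join_elim _ _ _ ih₁ ih₂
  | meet_elim_1 _ _ _ _ hQ ih => exact .meet_elim_1 _ _ _ ih (hQ.rename hr)
  | meet_elim_2 _ _ _ hQ _ ih => exact .meet_elim_2 _ _ _ (hQ.rename hr) ih
  | meet_intro _ _ _ _ _ ih₁ ih₂ => exact .meet_intro _ _ _ ih₁ ih₂

theorem SubQual.of_top (hQ : WfQual Γ Q) : ∀ {P}, SubQual Γ .top P → SubQual Γ Q P
  | _, .top _ hΓ _ => .top _ hΓ hQ
  | _, .join_intro_1 _ _ _ h hR => .join_intro_1 _ _ _ (h.of_top hQ) hR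
  | _, .join_intro_2 _ _ _ hR h => .join_intro_2 _ _ _ hR (h.of_top hQ)
  | _, .meet_intro _ _ _ h₁ h₂ => .meet_intro _ _ _ (h₁.of_top hQ) (h₂.of_top hQ)

theorem SubQual.of_join_left : ∀ {P}, SubQual Γ (.join Q R) P → SubQual Γ Q P
  | _, .top _ hΓ (.join _ _ hQ _) => .top _ hΓ hQ
  | _, .join_intro_1 _ _ _ h hR => .join_intro_1 _ _ _ h.of_join_left hR
  | _, .join_intro_2 _ _ _ hR h => .join_intro_2 _ _ _ hR h.of_join_left
  | _, .join_elim _ _ _ h _ => h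
  | _, .meet_intro _ _ _ h₁ h₂ => .meet_intro _ _ _ h₁.of_join_left h₂.of_join_left

theorem SubQual.of_join_right : ∀ {P}, SubQual Γ (.join Q R) P → SubQual Γ R P
  | _, .top _ hΓ (.join _ _ _ hR) => .top _ hΓ hR
  | _, .join_intro_1 _ _ _ h hR => .join_intro_1 _ _ _ h.of_join_right hR
  | _, .join_intro_2 _ _ _ hR h => .join_intro_2 _ _ _ hR h.of_join_right
  | _, .join_elim _ _ _ _ h => h
  | _, .meet_intro _ _ _ h₁ h₂ => .meet_intro _ _ _ h₁.of_join_right h₂.of_join_right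

/-- `R₁ ∧ R₂ <: P` cannot be inverted, as `P` may be a meet or a join; composition from the left
commutes with the rules for `P` until one of the two elimination rules is reached. -/
theorem SubQual.of_meet {R₁ R₂ : Qual} (hQ : WfQual Γ Q)
    (h₁ : ∀ {P}, SubQual Γ R₁ P → SubQual Γ Q P) (h₂ : ∀ {P}, SubQual Γ R₂ P → SubQual Γ Q P) :
    ∀ {P}, SubQual Γ (.meet R₁ R₂) P → SubQual Γ Q P
  | _, .top _ hΓ _ => .top _ hΓ hQ
  | _, .join_intro_1 _ _ _ h hR => .join_intro_1 _ _ _ (of_meet hQ h₁ h₂ h) hR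
  | _, .join_intro_2 _ _ _ hR h => .join_intro_2 _ _ _ hR (of_meet hQ h₁ h₂ h)
  | _, .meet_intro _ _ _ h h' => .meet_intro _ _ _ (of_meet hQ h₁ h₂ h) (of_meet hQ h₁ h₂ h')
  | _, .meet_elim_1 _ _ _ h _ => h₁ h
  | _, .meet_elim_2 _ _ _ _ h => h₂ h

theorem SubQual.trans (h : SubQual Γ Q R) (hR : SubQual Γ R P) : SubQual Γ Q P := by
  induction h generalizing P with
  | top _ _ hQ => exact hR.of_top hQ
  | bot _ hΓ _ => exact .bot _ hΓ hR.wf_right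
  | refl_var _ _ _ => exact hR
  | var _ _ _ hY _ ih => exact .var _ _ _ hY (ih hR)
  | join_intro_1 _ _ _ _ _ ih => exact ih hR.of_join_left
  | join_intro_2 _ _ _ _ _ ih => exact ih hR.of_join_right
  | join_elim _ _ _ _ _ ih₁ ih₂ => exact .join_elim _ _ _ (ih₁ hR) (ih₂ hR)
  | meet_elim_1 _ _ _ _ hQ ih => exact .meet_elim_1 _ _ _ (ih hR) hQ
  | meet_elim_2 _ _ _ hQ _ ih => exact .meet_elim_2 _ _ _ hQ (ih hR)
  | meet_intro _ _ _ h _ ih₁ ih₂ => exact .of_meet h.wf_left ih₁ ih₂ hR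

/-! ### Subtyping -/

theorem Sub.wf {A B : Ty k} (h : Sub Γ A B) : WfEnv Γ ∧ WfTy Γ A ∧ WfTy Γ B := by
  induction h with
  | top _ _ hΓ hS => exact ⟨hΓ, hS, .top _⟩
  | refl_var _ _ hΓ hX => exact ⟨hΓ, hX, hX⟩
  | var _ _ _ _ hX _ ih => exact ⟨ih.1, .var _ _ _ hX, ih.2.2⟩
  | arrow _ _ _ _ _ _ _ ih₁ ih₂ =>
    exact ⟨ih₁.1, .arrow _ _ _ ih₁.2.2 ih₂.2.1, .arrow _ _ _ ih₁.2.1 ih₂.2.2⟩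
  | all _ S₁ _ _ _ _ _ ih₁ ih₂ =>
    have hT₁ := ih₂.2.1.of_wfSubst_var (.changeTy _ _ S₁)
    exact ⟨ih₁.1, .all _ _ _ ih₁.2.2 hT₁, .all _ _ _ ih₁.2.1 ih₂.2.2⟩
  | qall _ Q₁ _ _ _ hQ _ ih =>
    have hT₁ := ih.2.1.of_wfSubst_var (.changeQu _ _ Q₁)
    exact ⟨hQ.wfEnv, .qall _ _ _ hQ.wf_right hT₁, .qall _ _ _ hQ.wf_left ih.2.2⟩
  | qtype _ _ _ _ _ hQ _ ih =>
    exact ⟨ih.1, .qual _ _ _ hQ.wf_left ih.2.1, .qual _ _ _ hQ.wf_right ih.2.2⟩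

theorem Sub.wfEnv {A B : Ty k} (h : Sub Γ A B) : WfEnv Γ := h.wf.1

theorem Sub.wf_left {A B : Ty k} (h : Sub Γ A B) : WfTy Γ A := h.wf.2.1

theorem Sub.wf_right {A B : Ty k} (h : Sub Γ A B) : WfTy Γ B := h.wf.2.2

theorem Sub.refl {T : Ty k} (hΓ : WfEnv Γ) (hT : WfTy Γ T) : Sub Γ T T := by
  induction hT with
  | top => exact .top _ _ hΓ (.top _)
  | var _ _ _ hX => exact .refl_var _ _ hΓ (.var _ _ _ hX)
  | arrow _ _ _ _ _ ih₁ ih₂ => exact .arrow _ _ _ _ _ (ih₁ hΓ) (ih₂ hΓ)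
  | all _ _ _ hS _ ih₁ ih₂ => exact .all _ _ _ _ _ (ih₁ hΓ) (ih₂ (.ty _ _ hΓ hS))
  | qall _ _ _ hQ _ ih => exact .qall _ _ _ _ _ (.refl hΓ hQ) (ih (.qu _ _ hΓ hQ))
  | qual _ _ _ hQ _ ih => exact .qtype _ _ _ _ _ (.refl hΓ hQ) (ih hΓ)

theorem Sub.rename {A B : Ty k} (h : Sub Γ A B) (hΔ : WfEnv Δ) (hr : BoundRen Δ Γ ρ ξ) :
    Sub Δ (A.rename ρ ξ) (B.rename ρ ξ) := by
  induction h generalizing Δ ρ ξ with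
  | top _ _ _ hS => exact .top _ _ hΔ (hS.rename hr)
  | refl_var _ _ _ hX => exact .refl_var _ _ hΔ (hX.rename hr)
  | var _ _ _ _ hX _ ih => exact .var _ _ _ _ (hr.ty hX) (ih hΔ hr)
  | arrow _ _ _ _ _ _ _ ih₁ ih₂ => exact .arrow _ _ _ _ _ (ih₁ hΔ hr) (ih₂ hΔ hr)
  | all _ _ _ _ _ _ _ ih₁ ih₂ =>
    have hS := ih₁ hΔ hr
    exact .all _ _ _ _ _ hS (ih₂ (.ty _ _ hΔ hS.wf_left) (hr.consTy _))
  | qall _ _ _ _ _ hQ _ ih =>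
    have hQ := hQ.rename hΔ hr
    exact .qall _ _ _ _ _ hQ (ih (.qu _ _ hΔ hQ.wf_left) (hr.consQu _))
  | qtype _ _ _ _ _ hQ _ ih => exact .qtype _ _ _ _ _ (hQ.rename hΔ hr) (ih hΔ hr)

/-- Transitivity of subtyping through the middle type `B`, in every environment. -/
def TransThrough (B : Ty k) : Prop :=
  ∀ ⦃Γ : Env⦄ ⦃A C : Ty k⦄, Sub Γ A B → Sub Γ B C → Sub Γ A C

/-- The facts `Γ ⊢ A <: S` that can be composed with any `Γ ⊢ S <: B` before transitivity of
subtyping is known: the rule for a type variable with bound `S`, or a subtyping whose right-hand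
side `S` subtyping is already transitive through. All renamings of `S` are included in the latter
condition so that it survives weakening. -/
inductive ComposableSub (Γ : Env) : STy → STy → Prop
  | bound {X : ℕ} {S : STy} : HasTy Γ X S → ComposableSub Γ (.var X) S
  | sub {A S : STy} : (∀ ρ ξ, TransThrough (S.rename ρ ξ)) → Sub Γ A S → ComposableSub Γ A S

namespace ComposableSub

theorem rename {A : STy} (h : ComposableSub Γ A S) (hΔ : WfEnv Δ) (hr : BoundRen Δ Γ ρ ξ) :
    ComposableSub Δ (A.rename ρ ξ) (S.rename ρ ξ) := by
  cases h with
  | bound hX => exact .bound (hr.ty hX)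
  | sub ht h =>
    exact .sub (by simpa only [Ty.rename_rename] using fun _ _ ↦ ht _ _) (h.rename hΔ hr)

theorem wf_left {A : STy} : ComposableSub Γ A S → WfTy Γ A
  | .bound hX => .var _ _ _ hX
  | .sub _ h => h.wf_left

theorem trans {A B : STy} (h : ComposableSub Γ A S) (h' : Sub Γ S B) : Sub Γ A B := by
  cases h with
  | bound hX => exact .var _ _ _ _ hX h'
  | sub ht h =>
    have ht : TransThrough S := by simpa only [Ty.rename_id] using ht id id
    exact ht h h'

end ComposableSub

/-- A substitution for the type and qualifier variables of `Γ` by types and qualifiers over `Δ`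
that lie below the substituted bounds. It carries subqualification and subtyping in `Γ` over to
`Δ`. -/
structure BoundSubst (Δ Γ : Env) (τ : ℕ → STy) (θ : ℕ → Qual) : Prop where
  ty : ∀ {X S}, HasTy Γ X S → ComposableSub Δ (τ X) (S.subst τ θ)
  qu : ∀ {Y Q}, HasQu Γ Y Q → SubQual Δ (θ Y) (Q.subst θ)

namespace BoundSubst

theorem wfSubst (h : BoundSubst Δ Γ τ θ) : WfSubst Δ Γ τ θ where
  ty hX := (h.ty hX).wf_left
  qu hY := (h.qu hY).wf_left

theorem consTm {T : QTy} (h : BoundSubst Δ Γ τ θ) (T' : QTy) (hΔ : WfEnv (.tm T :: Δ)) :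
    BoundSubst (.tm T :: Δ) (.tm T' :: Γ) τ θ where
  ty | .tm _ _ _ _ hX => by simpa only [Ty.rename_id] using (h.ty hX).rename hΔ (.shiftTm _ _)
  qu | .tm _ _ _ _ hY => by simpa only [Qual.rename_id] using (h.qu hY).rename hΔ (.shiftTm _ _)

theorem consTy (h : BoundSubst Δ Γ τ θ) (hΔ : WfEnv (.ty (S.subst τ θ) :: Δ)) :
    BoundSubst (.ty (S.subst τ θ) :: Δ) (.ty S :: Γ) (Ty.lift τ) θ where
  ty
    | .here _ _ => by rw [Ty.subst_shiftTy]; exact .bound (.here _ _)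
    | .ty _ _ _ _ hX => by rw [Ty.subst_shiftTy]; exact (h.ty hX).rename hΔ (.shiftTy _ _)
  qu | .ty _ _ _ _ hY => by simpa only [Qual.rename_id] using (h.qu hY).rename hΔ (.shiftTy _ _)

theorem consQu (h : BoundSubst Δ Γ τ θ) (hΔ : WfEnv (.qu (Q.subst θ) :: Δ)) :
    BoundSubst (.qu (Q.subst θ) :: Δ) (.qu Q :: Γ) (fun n ↦ (τ n).shiftQual) (Qual.lift θ) where
  ty | .qu _ _ _ _ hX => by rw [Ty.subst_shiftQual]; exact (h.ty hX).rename hΔ (.shiftQual _ _)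
  qu
    | .here _ _ => by rw [Qual.subst_rename_succ]; exact (HasQu.here _ _).subQual hΔ
    | .qu _ _ _ _ hY => by rw [Qual.subst_rename_succ]; exact (h.qu hY).rename hΔ (.shiftQual _ _)

theorem id (hΓ : WfEnv Γ) : BoundSubst Γ Γ .var .var where
  ty hX := by rw [Ty.subst_var]; exact .bound hX
  qu hY := by rw [Qual.subst_var]; exact hY.subQual hΓ

theorem dropTm (hΓ : WfEnv Γ) (T : QTy) : BoundSubst Γ (.tm T :: Γ) .var .var where
  ty | .tm _ _ _ _ hX => (BoundSubst.id hΓ).ty hX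
  qu | .tm _ _ _ _ hY => (BoundSubst.id hΓ).qu hY

theorem narrowTy (hS : Sub Γ S' S) (ht : ∀ ρ ξ, TransThrough (S.rename ρ ξ)) :
    BoundSubst (.ty S' :: Γ) (.ty S :: Γ) .var .var :=
  have hΔ := WfEnv.ty _ _ hS.wfEnv hS.wf_left
  { ty := fun
      | .here _ _ => by
        rw [Ty.subst_var]
        exact .sub (by simpa only [Ty.shiftTy, Ty.rename_rename] using fun _ _ ↦ ht _ _)
          (.var _ _ _ _ (.here _ _) (hS.rename hΔ (.shiftTy _ _)))
      | .ty _ _ _ _ hX => (BoundSubst.id hΔ).ty (.ty _ _ _ _ hX)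
    qu := fun | .ty _ _ _ _ hY => (BoundSubst.id hΔ).qu (.ty _ _ _ _ hY) }

theorem narrowQu (hQ : SubQual Γ Q' Q) : BoundSubst (.qu Q' :: Γ) (.qu Q :: Γ) .var .var :=
  have hΔ := WfEnv.qu _ _ hQ.wfEnv hQ.wf_left
  { ty := fun | .qu _ _ _ _ hX => (BoundSubst.id hΔ).ty (.qu _ _ _ _ hX)
    qu := fun
      | .here _ _ => by
        rw [Qual.subst_var]
        exact .var _ _ _ (.here _ _) (hQ.rename hΔ (.shiftQual _ _))
      | .qu _ _ _ _ hY => (BoundSubst.id hΔ).qu (.qu _ _ _ _ hY) }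

end BoundSubst

theorem SubQual.subst (h : SubQual Γ Q R) (hΔ : WfEnv Δ) (hs : BoundSubst Δ Γ τ θ) :
    SubQual Δ (Q.subst θ) (R.subst θ) := by
  have hw := hs.wfSubst
  induction h with
  | top _ _ hQ => exact .top _ hΔ (hQ.subst hw)
  | bot _ _ hQ => exact .bot _ hΔ (hQ.subst hw)
  | refl_var _ _ hY => exact .refl hΔ (hY.subst hw)
  | var _ _ _ hY _ ih => exact (hs.qu hY).trans ih
  | join_intro_1 _ _ _ _ hR ih => exact .join_intro_1 _ _ _ ih (hR.subst hw)
  | join_intro_2 _ _ _ hR _ ih => exact .join_intro_2 _ _ _ (hR.subst hw) ih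
  | join_elim _ _ _ _ _ ih₁ ih₂ => exact .join_elim _ _ _ ih₁ ih₂
  | meet_elim_1 _ _ _ _ hQ ih => exact .meet_elim_1 _ _ _ ih (hQ.subst hw)
  | meet_elim_2 _ _ _ hQ _ ih => exact .meet_elim_2 _ _ _ (hQ.subst hw) ih
  | meet_intro _ _ _ _ _ ih₁ ih₂ => exact .meet_intro _ _ _ ih₁ ih₂

theorem Sub.subst {A B : Ty k} (h : Sub Γ A B) (hΔ : WfEnv Δ) (hs : BoundSubst Δ Γ τ θ) :
    Sub Δ (A.subst τ θ) (B.subst τ θ) := by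
  induction h generalizing Δ τ θ with
  | top _ _ _ hS => exact .top _ _ hΔ (hS.subst hs.wfSubst)
  | refl_var _ _ _ hX => exact .refl hΔ (hX.subst hs.wfSubst)
  | var _ _ _ _ hX _ ih => exact (hs.ty hX).trans (ih hΔ hs)
  | arrow _ _ _ _ _ _ _ ih₁ ih₂ => exact .arrow _ _ _ _ _ (ih₁ hΔ hs) (ih₂ hΔ hs)
  | all _ _ _ _ _ _ _ ih₁ ih₂ =>
    have hS := ih₁ hΔ hs
    have hΔ' := WfEnv.ty _ _ hΔ hS.wf_left
    exact .all _ _ _ _ _ hS (ih₂ hΔ' (hs.consTy hΔ'))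
  | qall _ _ _ _ _ hQ _ ih =>
    have hQ := hQ.subst hΔ hs
    have hΔ' := WfEnv.qu _ _ hΔ hQ.wf_left
    exact .qall _ _ _ _ _ hQ (ih hΔ' (hs.consQu hΔ'))
  | qtype _ _ _ _ _ hQ _ ih => exact .qtype _ _ _ _ _ (hQ.subst hΔ hs) (ih hΔ hs)

theorem Sub.narrowTy {A B : Ty k} (h : Sub (.ty S :: Γ) A B) (hS : Sub Γ S' S)
    (ht : ∀ ρ ξ, TransThrough (S.rename ρ ξ)) : Sub (.ty S' :: Γ) A B := by
  simpa only [Ty.subst_var] using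
    h.subst (.ty _ _ hS.wfEnv hS.wf_left) (.narrowTy hS ht)

theorem Sub.narrowQu {A B : Ty k} (h : Sub (.qu Q :: Γ) A B) (hQ : SubQual Γ Q' Q) :
    Sub (.qu Q' :: Γ) A B := by
  simpa only [Ty.subst_var] using h.subst (.qu _ _ hQ.wfEnv hQ.wf_left) (.narrowQu hQ)

/-- Subtyping is transitive through the immediate components of a type, and through all renamings
of the bound of a `∀(X <: S). T`, the part that narrowing moves below binders. -/
def TransThroughParts : {k : Kind} → Ty k → Prop
  | _, .top => True
  | _, .var _ => True
  | _, .arrow T₁ T₂ => TransThrough T₁ ∧ TransThrough T₂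
  | _, .all S T => (∀ ρ ξ, TransThrough (S.rename ρ ξ)) ∧ TransThrough T
  | _, .qall _ T => TransThrough T
  | _, .qual _ S => TransThrough S

theorem TransThrough.of_parts {B : Ty k} (hB : TransThroughParts B) : TransThrough B := by
  intro Γ A C hAB hBC
  induction hAB with
  | top _ _ hΓ hA => cases hBC with | top => exact .top _ _ hΓ hA
  | refl_var => exact hBC
  | var _ _ _ _ hX _ ih => exact .var _ _ _ _ hX (ih hB hBC)
  | arrow _ _ _ _ _ h₁ h₂ =>
    cases hBC with
    | top _ _ hΓ _ => exact .top _ _ hΓ (.arrow _ _ _ h₁.wf_right h₂.wf_left)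
    | arrow _ _ _ _ _ h₁' h₂' => exact .arrow _ _ _ _ _ (hB.1 h₁' h₁) (hB.2 h₂ h₂')
  | all _ _ S₂ _ _ hS hT =>
    cases hBC with
    | top _ _ hΓ _ => exact .top _ _ hΓ (Sub.all _ _ _ _ _ hS hT).wf_left
    | all _ _ _ _ _ hS' hT' =>
      have hS₂ : TransThrough S₂ := by simpa only [Ty.rename_id] using hB.1 id id
      exact .all _ _ _ _ _ (hS₂ hS' hS) (hB.2 (hT.narrowTy hS' hB.1) hT')
  | qall _ _ _ _ _ hQ hT =>
    cases hBC with
    | top _ _ hΓ _ => exact .top _ _ hΓ (Sub.qall _ _ _ _ _ hQ hT).wf_left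
    | qall _ _ _ _ _ hQ' hT' => exact .qall _ _ _ _ _ (hQ'.trans hQ) (hB (hT.narrowQu hQ') hT')
  | qtype _ _ _ _ _ hQ hS =>
    cases hBC with
    | qtype _ _ _ _ _ hQ' hS' => exact .qtype _ _ _ _ _ (hQ.trans hQ') (hB hS hS')

theorem transThrough_rename (B : Ty k) (ρ ξ : ℕ → ℕ) : TransThrough (B.rename ρ ξ) := by
  induction B generalizing ρ ξ with
  | top | var => exact .of_parts trivial
  | arrow _ _ ih₁ ih₂ => exact .of_parts ⟨ih₁ _ _, ih₂ _ _⟩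
  | all _ _ ihS ihT =>
    exact .of_parts ⟨by simpa only [Ty.rename_rename] using fun _ _ ↦ ihS _ _, ihT _ _⟩
  | qall _ _ ih | qual _ _ ih => exact .of_parts (ih _ _)

theorem Sub.trans {A B C : Ty k} (h : Sub Γ A B) (h' : Sub Γ B C) : Sub Γ A C := by
  have ht : TransThrough B := by simpa only [Ty.rename_id] using transThrough_rename B id id
  exact ht h h'

theorem BoundSubst.singleTy (h : Sub Γ S' S) : BoundSubst Γ (.ty S :: Γ) (.single S') .var where
  ty
    | .here _ _ => by
      rw [← Ty.instTy, Ty.instTy_shiftTy]; exact .sub (transThrough_rename S) h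
    | .ty _ _ _ _ hX => by rw [← Ty.instTy, Ty.instTy_shiftTy]; exact .bound hX
  qu | .ty _ _ _ _ hY => (BoundSubst.id h.wfEnv).qu hY

theorem BoundSubst.singleQual (h : SubQual Γ Q' Q) :
    BoundSubst Γ (.qu Q :: Γ) .var (.single Q') where
  ty | .qu _ _ _ _ hX => by rw [← Ty.instQual, Ty.instQual_shiftQual]; exact .bound hX
  qu
    | .here _ _ => by rw [Qual.subst_single_rename_succ]; exact h
    | .qu _ _ _ _ hY => by rw [Qual.subst_single_rename_succ]; exact hY.subQual h.wfEnv

theorem Sub.instTy {A B : Ty k} (h : Sub (.ty S :: Γ) A B) (hS : Sub Γ S' S) :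
    Sub Γ (A.instTy S') (B.instTy S') :=
  h.subst hS.wfEnv (.singleTy hS)

theorem Sub.instQual {A B : Ty k} (h : Sub (.qu Q :: Γ) A B) (hQ : SubQual Γ Q' Q) :
    Sub Γ (A.instQual Q') (B.instQual Q') :=
  h.subst hQ.wfEnv (.singleQual hQ)

/-! ### Typing -/

theorem Typing.wfEnv {T : QTy} (h : Typing Γ t T) : WfEnv Γ := by
  induction h with
  | var _ _ _ hΓ _ => exact hΓ
  | abs _ _ _ _ _ _ _ ih | t_abs _ _ _ _ _ _ _ ih | q_abs _ _ _ _ _ _ _ ih => exact ih.tail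
  | app _ _ _ _ _ _ _ _ ih _ | t_app _ _ _ _ _ _ _ _ ih | q_app _ _ _ _ _ _ _ _ ih
  | typ_assert _ _ _ _ _ _ _ ih | typ_upqual _ _ _ _ _ _ _ ih | sub _ _ _ _ _ _ ih => exact ih

theorem Typing.wfTy {T : QTy} (h : Typing Γ t T) : WfTy Γ T := by
  induction h with
  | var _ _ _ hΓ hx => exact hx.wfTy hΓ
  | abs _ _ _ _ _ hP h ih =>
    exact .qual _ _ _ hP (.arrow _ _ _ h.wfEnv.head_tm (ih.of_wfSubst_var (.dropTm _ _)))
  | t_abs _ _ _ _ _ hP h ih => exact .qual _ _ _ hP (.all _ _ _ h.wfEnv.head_ty ih)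
  | q_abs _ _ _ _ _ hP h ih => exact .qual _ _ _ hP (.qall _ _ _ h.wfEnv.head_qu ih)
  | app _ _ _ _ _ _ _ _ ih _ =>
    have .qual _ _ _ _ (.arrow _ _ _ _ hT) := ih
    exact hT
  | t_app _ _ _ _ _ _ _ hS ih =>
    have .qual _ _ _ _ (.all _ _ _ _ hT) := ih
    exact hT.subst (.singleTy hS.wf_left _)
  | q_app _ _ _ _ _ _ _ hQ ih =>
    have .qual _ _ _ _ (.qall _ _ _ _ hT) := ih
    exact hT.subst (.singleQual hQ.wf_left _)
  | typ_assert _ _ _ _ _ _ _ ih => exact ih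
  | typ_upqual _ _ _ _ _ _ hQ ih =>
    have .qual _ _ _ _ hS := ih
    exact .qual _ _ _ hQ.wf_right hS
  | sub _ _ _ _ _ hs _ => exact hs.wf_right

/-- A renaming of the variables of `Γ` by variables of `Δ` with the same types and bounds. It
carries typing in `Γ` over to `Δ`. -/
structure EnvRen (Δ Γ : Env) (χ ρ ξ : ℕ → ℕ) : Prop extends BoundRen Δ Γ ρ ξ where
  tm : ∀ {x T}, HasTm Γ x T → HasTm Δ (χ x) (T.rename ρ ξ)

namespace EnvRen

theorem consTm (h : EnvRen Δ Γ χ ρ ξ) (T : QTy) :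
    EnvRen (.tm (T.rename ρ ξ) :: Δ) (.tm T :: Γ) (liftRen χ) ρ ξ where
  toBoundRen := h.toBoundRen.consTm _ _
  tm
    | .here _ _ => .here _ _
    | .tm _ _ _ _ hx => .tm _ _ _ _ (h.tm hx)

theorem consTy (h : EnvRen Δ Γ χ ρ ξ) (S : STy) :
    EnvRen (.ty (S.rename ρ ξ) :: Δ) (.ty S :: Γ) χ (liftRen ρ) ξ where
  toBoundRen := h.toBoundRen.consTy _
  tm | .ty _ _ _ _ hx => by rw [Ty.rename_shiftTy]; exact .ty _ _ _ _ (h.tm hx)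

theorem consQu (h : EnvRen Δ Γ χ ρ ξ) (Q : Qual) :
    EnvRen (.qu (Q.rename ξ) :: Δ) (.qu Q :: Γ) χ ρ (liftRen ξ) where
  toBoundRen := h.toBoundRen.consQu _
  tm | .qu _ _ _ _ hx => by rw [Ty.rename_shiftQual]; exact .qu _ _ _ _ (h.tm hx)

theorem shiftTm (Γ : Env) (T : QTy) : EnvRen (.tm T :: Γ) Γ Nat.succ id id where
  toBoundRen := .shiftTm _ _
  tm hx := by rw [Ty.rename_id]; exact .tm _ _ _ _ hx

theorem shiftTy (Γ : Env) (S : STy) : EnvRen (.ty S :: Γ) Γ id Nat.succ id where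
  toBoundRen := .shiftTy _ _
  tm hx := .ty _ _ _ _ hx

theorem shiftQual (Γ : Env) (Q : Qual) : EnvRen (.qu Q :: Γ) Γ id id Nat.succ where
  toBoundRen := .shiftQual _ _
  tm hx := .qu _ _ _ _ hx

end EnvRen

theorem Typing.rename {T : QTy} (h : Typing Γ t T) (hΔ : WfEnv Δ) (hr : EnvRen Δ Γ χ ρ ξ) :
    Typing Δ (t.rename χ ρ ξ) (T.rename ρ ξ) := by
  induction h generalizing Δ χ ρ ξ with
  | var _ _ _ _ hx => exact .var _ _ _ hΔ (hr.tm hx)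
  | abs _ _ _ _ _ hP h ih =>
    have hT := h.wfEnv.head_tm.rename hr.toBoundRen
    exact .abs _ _ _ _ _ (hP.rename hr.toBoundRen) (ih (.tm _ _ hΔ hT) (hr.consTm _))
  | t_abs _ _ _ _ _ hP h ih =>
    have hS := h.wfEnv.head_ty.rename hr.toBoundRen
    exact .t_abs _ _ _ _ _ (hP.rename hr.toBoundRen) (ih (.ty _ _ hΔ hS) (hr.consTy _))
  | q_abs _ _ _ _ _ hP h ih =>
    have hQ := h.wfEnv.head_qu.rename hr.toBoundRen
    exact .q_abs _ _ _ _ _ (hP.rename hr.toBoundRen) (ih (.qu _ _ hΔ hQ) (hr.consQu _))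
  | app _ _ _ _ _ _ _ _ ih₁ ih₂ => exact .app _ _ _ _ _ _ (ih₁ hΔ hr) (ih₂ hΔ hr)
  | t_app _ _ _ _ _ _ _ hS ih =>
    rw [Ty.rename_instTy]
    exact .t_app _ _ _ _ _ _ (ih hΔ hr) (hS.rename hΔ hr.toBoundRen)
  | q_app _ _ _ _ _ _ _ hQ ih =>
    rw [Ty.rename_instQual]
    exact .q_app _ _ _ _ _ _ (ih hΔ hr) (hQ.rename hΔ hr.toBoundRen)
  | typ_assert _ _ _ _ _ _ hQ ih =>
    exact .typ_assert _ _ _ _ _ (ih hΔ hr) (hQ.rename hΔ hr.toBoundRen)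
  | typ_upqual _ _ _ _ _ _ hQ ih =>
    exact .typ_upqual _ _ _ _ _ (ih hΔ hr) (hQ.rename hΔ hr.toBoundRen)
  | sub _ _ _ _ _ hs ih => exact .sub _ _ _ _ (ih hΔ hr) (hs.rename hΔ hr.toBoundRen)

/-- A substitution for the variables of `Γ` by terms over `Δ` of the substituted types, and by types
and qualifiers over `Δ` below the substituted bounds. It carries typing in `Γ` over to `Δ`. -/
structure EnvSubst (Δ Γ : Env) (σ : ℕ → Tm) (τ : ℕ → STy) (θ : ℕ → Qual) : Prop
    extends BoundSubst Δ Γ τ θ where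
  tm : ∀ {x T}, HasTm Γ x T → Typing Δ (σ x) (T.subst τ θ)

namespace EnvSubst

theorem consTm {T : QTy} (h : EnvSubst Δ Γ σ τ θ) (hΔ : WfEnv (.tm (T.subst τ θ) :: Δ)) :
    EnvSubst (.tm (T.subst τ θ) :: Δ) (.tm T :: Γ) (Tm.lift σ) τ θ where
  toBoundSubst := h.toBoundSubst.consTm _ hΔ
  tm
    | .here _ _ => .var _ _ _ hΔ (.here _ _)
    | .tm _ _ _ _ hx => by
      simpa only [Ty.rename_id, Tm.lift] using (h.tm hx).rename hΔ (.shiftTm _ _)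

theorem consTy (h : EnvSubst Δ Γ σ τ θ) (hΔ : WfEnv (.ty (S.subst τ θ) :: Δ)) :
    EnvSubst (.ty (S.subst τ θ) :: Δ) (.ty S :: Γ)
      (fun n ↦ (σ n).rename id Nat.succ id) (Ty.lift τ) θ where
  toBoundSubst := h.toBoundSubst.consTy hΔ
  tm | .ty _ _ _ _ hx => by rw [Ty.subst_shiftTy]; exact (h.tm hx).rename hΔ (.shiftTy _ _)

theorem consQu (h : EnvSubst Δ Γ σ τ θ) (hΔ : WfEnv (.qu (Q.subst θ) :: Δ)) :
    EnvSubst (.qu (Q.subst θ) :: Δ) (.qu Q :: Γ)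
      (fun n ↦ (σ n).rename id id Nat.succ) (fun n ↦ (τ n).shiftQual) (Qual.lift θ) where
  toBoundSubst := h.toBoundSubst.consQu hΔ
  tm | .qu _ _ _ _ hx => by rw [Ty.subst_shiftQual]; exact (h.tm hx).rename hΔ (.shiftQual _ _)

theorem singleTm {U : QTy} (hv : Typing Γ v U) :
    EnvSubst Γ (.tm U :: Γ) (.single v) .var .var where
  toBoundSubst := .dropTm hv.wfEnv _
  tm
    | .here _ _ => by rw [Ty.subst_var]; exact hv
    | .tm _ _ _ _ hx => by rw [Ty.subst_var]; exact .var _ _ _ hv.wfEnv hx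

theorem singleTy (hS : Sub Γ S' S) : EnvSubst Γ (.ty S :: Γ) .var (.single S') .var where
  toBoundSubst := .singleTy hS
  tm
    | .ty _ _ _ _ hx => by
      rw [← Ty.instTy, Ty.instTy_shiftTy]; exact .var _ _ _ hS.wfEnv hx

theorem singleQual (hQ : SubQual Γ Q' Q) : EnvSubst Γ (.qu Q :: Γ) .var .var (.single Q') where
  toBoundSubst := .singleQual hQ
  tm
    | .qu _ _ _ _ hx => by
      rw [← Ty.instQual, Ty.instQual_shiftQual]; exact .var _ _ _ hQ.wfEnv hx

end EnvSubst

theorem Typing.subst {T : QTy} (h : Typing Γ t T) (hΔ : WfEnv Δ) (hs : EnvSubst Δ Γ σ τ θ) :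
    Typing Δ (t.subst σ τ θ) (T.subst τ θ) := by
  induction h generalizing Δ σ τ θ with
  | var _ _ _ _ hx => exact hs.tm hx
  | abs _ _ _ _ _ hP h ih =>
    have hΔ' := WfEnv.tm _ _ hΔ (h.wfEnv.head_tm.subst hs.wfSubst)
    exact .abs _ _ _ _ _ (hP.subst hs.wfSubst) (ih hΔ' (hs.consTm hΔ'))
  | t_abs _ _ _ _ _ hP h ih =>
    have hΔ' := WfEnv.ty _ _ hΔ (h.wfEnv.head_ty.subst hs.wfSubst)
    exact .t_abs _ _ _ _ _ (hP.subst hs.wfSubst) (ih hΔ' (hs.consTy hΔ'))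
  | q_abs _ _ _ _ _ hP h ih =>
    have hΔ' := WfEnv.qu _ _ hΔ (h.wfEnv.head_qu.subst hs.wfSubst)
    exact .q_abs _ _ _ _ _ (hP.subst hs.wfSubst) (ih hΔ' (hs.consQu hΔ'))
  | app _ _ _ _ _ _ _ _ ih₁ ih₂ => exact .app _ _ _ _ _ _ (ih₁ hΔ hs) (ih₂ hΔ hs)
  | t_app _ _ _ _ _ _ _ hS ih =>
    rw [Ty.subst_instTy]
    exact .t_app _ _ _ _ _ _ (ih hΔ hs) (hS.subst hΔ hs.toBoundSubst)
  | q_app _ _ _ _ _ _ _ hQ ih =>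
    rw [Ty.subst_instQual]
    exact .q_app _ _ _ _ _ _ (ih hΔ hs) (hQ.subst hΔ hs.toBoundSubst)
  | typ_assert _ _ _ _ _ _ hQ ih =>
    exact .typ_assert _ _ _ _ _ (ih hΔ hs) (hQ.subst hΔ hs.toBoundSubst)
  | typ_upqual _ _ _ _ _ _ hQ ih =>
    exact .typ_upqual _ _ _ _ _ (ih hΔ hs) (hQ.subst hΔ hs.toBoundSubst)
  | sub _ _ _ _ _ hT ih => exact .sub _ _ _ _ (ih hΔ hs) (hT.subst hΔ hs.toBoundSubst)

theorem Typing.instTm {T U : QTy} (ht : Typing (.tm U :: Γ) t T) (hv : Typing Γ v U) :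
    Typing Γ (t.instTm v) T := by
  simpa only [Ty.subst_var, Tm.instTm] using ht.subst hv.wfEnv (.singleTm hv)

theorem Typing.instTy {T : QTy} (ht : Typing (.ty S :: Γ) t T) (hS : Sub Γ S' S) :
    Typing Γ (t.instTy S') (T.instTy S') :=
  ht.subst hS.wfEnv (.singleTy hS)

theorem Typing.instQual {T : QTy} (ht : Typing (.qu Q :: Γ) t T) (hQ : SubQual Γ Q' Q) :
    Typing Γ (t.instQual Q') (T.instQual Q') :=
  ht.subst hQ.wfEnv (.singleQual hQ)

theorem Typing.abs_inv {T : QTy} (h : Typing Γ (.abs P t) T) :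
    ∃ T₁ T₂, Typing (.tm T₁ :: Γ) t T₂ ∧ Sub Γ (.qual P (.arrow T₁ T₂)) T := by
  generalize hs : Tm.abs P t = s at h
  induction h with
  | abs _ _ _ _ _ hP h _ =>
    cases hs
    exact ⟨_, _, h, .refl h.wfEnv.tail (Typing.abs _ _ _ _ _ hP h).wfTy⟩
  | sub _ _ _ _ _ hT ih =>
    obtain ⟨T₁, T₂, ht, hT₁⟩ := ih hs
    exact ⟨T₁, T₂, ht, hT₁.trans hT⟩
  | _ => cases hs

theorem Typing.tabs_inv {T : QTy} (h : Typing Γ (.tabs P S t) T) :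
    ∃ U, Typing (.ty S :: Γ) t U ∧ Sub Γ (.qual P (.all S U)) T := by
  generalize hs : Tm.tabs P S t = s at h
  induction h with
  | t_abs _ _ _ _ _ hP h _ =>
    cases hs
    exact ⟨_, h, .refl h.wfEnv.tail (Typing.t_abs _ _ _ _ _ hP h).wfTy⟩
  | sub _ _ _ _ _ hT ih =>
    obtain ⟨U, ht, hU⟩ := ih hs
    exact ⟨U, ht, hU.trans hT⟩
  | _ => cases hs

theorem Typing.qabs_inv {T : QTy} (h : Typing Γ (.qabs P Q t) T) :
    ∃ U, Typing (.qu Q :: Γ) t U ∧ Sub Γ (.qual P (.qall Q U)) T := by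
  generalize hs : Tm.qabs P Q t = s at h
  induction h with
  | q_abs _ _ _ _ _ hP h _ =>
    cases hs
    exact ⟨_, h, .refl h.wfEnv.tail (Typing.q_abs _ _ _ _ _ hP h).wfTy⟩
  | sub _ _ _ _ _ hT ih =>
    obtain ⟨U, ht, hU⟩ := ih hs
    exact ⟨U, ht, hU.trans hT⟩
  | _ => cases hs

theorem Typing.beta_v {T U : QTy} (hf : Typing Γ (.abs P t) (.qual Q (.arrow T U)))
    (hv : Typing Γ v T) : Typing Γ (t.instTm v) U :=
  have ⟨_, _, ht, .qtype _ _ _ _ _ _ (.arrow _ _ _ _ _ hT hU)⟩ := hf.abs_inv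
  .sub _ _ _ _ (ht.instTm (.sub _ _ _ _ hv hT)) hU

theorem Typing.beta_T {S₀ : STy} {T : QTy} (hf : Typing Γ (.tabs P S₀ t) (.qual Q (.all S T)))
    (hS : Sub Γ S' S) : Typing Γ (t.instTy S') (T.instTy S') :=
  have ⟨_, ht, .qtype _ _ _ _ _ _ (.all _ _ _ _ _ hS₀ hT)⟩ := hf.tabs_inv
  .sub _ _ _ _ (ht.instTy (hS.trans hS₀)) (hT.instTy hS)

theorem Typing.beta_Q {Q₀ : Qual} {T : QTy} (hf : Typing Γ (.qabs P Q₀ t) (.qual R (.qall Q T)))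
    (hQ : SubQual Γ Q' Q) : Typing Γ (t.instQual Q') (T.instQual Q') :=
  have ⟨_, ht, .qtype _ _ _ _ _ _ (.qall _ _ _ _ _ hQ₀ hT)⟩ := hf.qabs_inv
  .sub _ _ _ _ (ht.instQual (hQ.trans hQ₀)) (hT.instQual hQ)

theorem Typing.retag (h : Typing Γ v (.qual Q S)) (hv : HasTag v P) (hR : WfQual Γ R) :
    Typing Γ (v.retag R) (.qual R S) := by
  have hRR := SubQual.refl h.wfEnv hR
  cases hv with
  | abs =>
    have ⟨_, _, ht, .qtype _ _ _ _ _ _ hS⟩ := h.abs_inv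
    exact .sub _ _ _ _ (.abs _ _ _ _ _ hR ht) (.qtype _ _ _ _ _ hRR hS)
  | tabs =>
    have ⟨_, ht, .qtype _ _ _ _ _ _ hS⟩ := h.tabs_inv
    exact .sub _ _ _ _ (.t_abs _ _ _ _ _ hR ht) (.qtype _ _ _ _ _ hRR hS)
  | qabs =>
    have ⟨_, ht, .qtype _ _ _ _ _ _ hS⟩ := h.qabs_inv
    exact .sub _ _ _ _ (.q_abs _ _ _ _ _ hR ht) (.qtype _ _ _ _ _ hRR hS)

end FsubQ

theorem mainTheorem1 (Γ : FsubQ.Env) (s t : FsubQ.Tm) (T : FsubQ.QTy)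
    (hs : FsubQ.Typing Γ s T) (hst : FsubQ.Step s t) :
    FsubQ.Typing Γ t T := by
  induction hs generalizing t with
  | var | abs | t_abs | q_abs => cases hst
  | app _ _ _ _ _ _ hf hv ihf ihv =>
    cases hst with
    | beta_v => exact hf.beta_v hv
    | app_fun _ _ _ h => exact .app _ _ _ _ _ _ (ihf _ h) hv
    | app_arg _ _ _ _ h => exact .app _ _ _ _ _ _ hf (ihv _ h)
  | t_app _ _ _ _ _ _ hf hS ih =>
    cases hst with
    | beta_T => exact hf.beta_T hS
    | tapp_congr _ _ _ h => exact .t_app _ _ _ _ _ _ (ih _ h) hS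
  | q_app _ _ _ _ _ _ hf hQ ih =>
    cases hst with
    | beta_Q => exact hf.beta_Q hQ
    | qapp_congr _ _ _ h => exact .q_app _ _ _ _ _ _ (ih _ h) hQ
  | typ_assert _ _ _ _ _ hv hQ ih =>
    cases hst with
    | assert => exact hv
    | assert_congr _ _ _ h => exact .typ_assert _ _ _ _ _ (ih _ h) hQ
  | typ_upqual _ _ _ _ _ hv hQ ih =>
    cases hst with
    | upqual _ _ _ hP _ => exact hv.retag hP hQ.wf_right
    | upqual_congr _ _ _ h => exact .typ_upqual _ _ _ _ _ (ih _ h) hQ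
  | sub _ _ _ _ _ hT ih => exact .sub _ _ _ _ (ih _ hst) hT
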